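/- Let $G$ be a finite simple undirected graph with $n$ vertices. The following three statements are equivalent. (i) $G$ is $12$-representable by a $123$-avoiding word. That is, the vertices of $G$ can be labeled bijectively by $1,\dots,n$ so that there is a word $w$ over $\{1,\dots,n\}$, containing each letter at least once, such that any two vertices with labels $i<j$ are adjacent if and only if every $j$ occurs before every $i$ in $w$, and there are no positions $a<b<c$ with $w_a<w_b<w_c$. (ii) $G$ has a linear vertex ordering $\prec$ that contains none of the following four patterns (pairs that are not mentioned may be edges or non-edges): (a) $x\prec y\prec z$ with $xy, yz\in E(G)$ and $xz\notin E(G)$; (b) $x\prec y\prec z\prec w$ with $yz\in E(G)$ and $xz, yw\notin E(G)$; (c) $x\prec y\prec z\prec w$ with $xz\in E(G)$ and $xw, yz\notin E(G)$; (d) $x\prec y\prec z\prec w$ with $yw\in E(G)$ and $xw, yz\notin E(G)$. (iii) $G$ is the complement of the intersection graph of unit-length hooks and sticks. Here a unit-length hook is the union of a vertical and a horizontal line segment in the plane, both of length $1$, such that the bottom endpoint of the vertical segment and the left endpoint of the horizontal segment are the same point, and this point (the corner) lies on the line $y=-x$. A unit-length stick is a horizontal or vertical line segment of length $1$ whose left,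 respectively bottom, endpoint lies on the line $y=-x$. In the intersection graph of such shapes the vertices correspond one-to-one to the shapes (distinct vertices have distinct shapes), and two distinct vertices are adjacent if and only if their shapes have a nonempty intersection. -/

import Mathlib

/-- The word `w` contains the pattern `p`: some subsequence of `w`, taken at positions
`f 0 < f 1 < ⋯`, has its letters in the same relative order (ties included) as the letters
of `p`. -/
def ContainsPattern {α : Type*} [LinearOrder α] (w : List α) (p : List ℕ) : Prop :=
  ∃ f : Fin p.length → Fin w.length, StrictMono f ∧
    ∀ a b, w.get (f a) < w.get (f b) ↔ p.get a < p.get b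

/-- `w` is `p`-avoiding. -/
def AvoidsPattern {α : Type*} [LinearOrder α] (w : List α) (p : List ℕ) : Prop :=
  ¬ ContainsPattern w p

/-- The word `w` `12`-represents the labeled graph `H` (the labels `1, …, n` are written
`0, …, n - 1`): every letter occurs in `w`, and `i < j` are adjacent iff every `j` occurs
before every `i` in `w`. -/
def Is12Representant {n : ℕ} (H : SimpleGraph (Fin n)) (w : List (Fin n)) : Prop :=
  (∀ i, i ∈ w) ∧
    ∀ i j, i < j →
      (H.Adj i j ↔ ∀ a b : Fin w.length, w.get a = j → w.get b = i → a < b)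

/-- An unlabeled graph `G` is `12`-representable by a `p`-avoiding word if some labeling of it
(a labeled graph `H` isomorphic to `G`) has a `p`-avoiding `12`-representant. -/
def Is12RepresentableAvoiding {V : Type*} [Fintype V] (G : SimpleGraph V) (p : List ℕ) : Prop :=
  ∃ H : SimpleGraph (Fin (Fintype.card V)), Nonempty (G ≃g H) ∧
    ∃ w : List (Fin (Fintype.card V)), Is12Representant H w ∧ AvoidsPattern w p

section Patterns

variable {V : Type*} [LinearOrder V] (G : SimpleGraph V)

/-- `x < y < z` with edges `xy`, `yz` and non-edge `xz`. -/
def HasPatternA : Prop :=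
  ∃ x y z : V, x < y ∧ y < z ∧ G.Adj x y ∧ G.Adj y z ∧ ¬ G.Adj x z

/-- `x < y < z < w` with edge `yz` and non-edges `xz`, `yw`. -/
def HasPatternB : Prop :=
  ∃ x y z w : V, x < y ∧ y < z ∧ z < w ∧ G.Adj y z ∧ ¬ G.Adj x z ∧ ¬ G.Adj y w

/-- `x < y < z < w` with edge `xz` and non-edges `xw`, `yz`. -/
def HasPatternC : Prop :=
  ∃ x y z w : V, x < y ∧ y < z ∧ z < w ∧ G.Adj x z ∧ ¬ G.Adj x w ∧ ¬ G.Adj y z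

/-- `x < y < z < w` with edge `yw` and non-edges `xw`, `yz`. -/
def HasPatternD : Prop :=
  ∃ x y z w : V, x < y ∧ y < z ∧ z < w ∧ G.Adj y w ∧ ¬ G.Adj x w ∧ ¬ G.Adj y z

end Patterns

/-- The `L`-shape with corner `c`, horizontal segment of length `h` going right and vertical
segment of length `v` going up. -/
def lShape (c : ℝ × ℝ) (h v : ℝ) : Set (ℝ × ℝ) :=
  segment ℝ c (c.1, c.2 + v) ∪ segment ℝ c (c.1 + h, c.2)

/-- A unit-length hook: an `L`-shape with corner on the line `y = -x`, both of whose segments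
have length `1`. -/
def IsUnitHook (S : Set (ℝ × ℝ)) : Prop :=
  ∃ c : ℝ × ℝ, c.2 = -c.1 ∧ S = lShape c 1 1

/-- A unit-length stick: a horizontal or vertical segment of length `1` whose left, respectively
bottom, endpoint lies on the line `y = -x`. -/
def IsUnitStick (S : Set (ℝ × ℝ)) : Prop :=
  ∃ c : ℝ × ℝ, c.2 = -c.1 ∧
    (S = segment ℝ c (c.1 + 1, c.2) ∨ S = segment ℝ c (c.1, c.2 + 1))

/-- The intersection graph of a family of sets. -/
def intersectionGraph {V X : Type*} (S : V → Set X) : SimpleGraph V where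
  Adj u v := u ≠ v ∧ (S u ∩ S v).Nonempty
  symm := ⟨fun u v h => ⟨h.1.symm, by rw [Set.inter_comm]; exact h.2⟩⟩
  loopless := ⟨fun _ h => h.1 rfl⟩

/-- `G` is the intersection graph of unit-length hooks and sticks. The model is a set of shapes
in one-to-one correspondence with the vertices, hence the injectivity. -/
def IsUnitHookStickGraph {V : Type*} (G : SimpleGraph V) : Prop :=
  ∃ S : V → Set (ℝ × ℝ), Function.Injective S ∧
    (∀ v, IsUnitHook (S v) ∨ IsUnitStick (S v)) ∧ G = intersectionGraph S

/-! Everything passes through `IsShiftModel`: vertices on a line, each with role `P`, `Q` or both,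
where `x < y` are non-adjacent iff `P x`, `Q y` and their distance is below `1`. A model yields a
word: put a letter `x` at `-c x` if `P x` and at `1 - c x` if `Q x`, and read from left to right;
this merges two decreasing sequences, so it avoids `123`. It also yields shapes with corners `(c x,
-c x)`: `P` grants the horizontal arm, `Q` the vertical one. Conversely, the label order of a word
and the order of the corners exclude the four patterns directly. The core is
`exists_isShiftModel_of_no_patterns`, which builds a model from a pattern-free order using
`exists_unit_placement`. -/

/-! ### From words to pattern-free orders -/

theorem containsPattern_123_iff {α : Type*} [LinearOrder α] (w : List α) :
    ContainsPattern w [1, 2, 3] ↔ ∃ a b c : Fin w.length, a < b ∧ b < c ∧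
      w.get a < w.get b ∧ w.get b < w.get c := by
  constructor
  · rintro ⟨f, hf, h⟩
    refine ⟨f (0 : Fin 3), f (1 : Fin 3), f (2 : Fin 3), hf (by decide), hf (by decide),
      (h _ _).2 (by decide), (h _ _).2 (by decide)⟩
  · rintro ⟨a, b, c, hab, hbc, h1, h2⟩
    have h3 := h1.trans h2
    have hac := hab.trans hbc
    refine ⟨(![a, b, c] : Fin 3 → _), ?_, ?_⟩
    · intro i j hij
      change Fin 3 at i j
      fin_cases i <;> fin_cases j <;> first | assumption | exact absurd hij (by decide)
    · intro i j
      change Fin 3 at i j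
      fin_cases i <;> fin_cases j
      · exact iff_of_false (lt_irrefl _) (by decide)
      · exact iff_of_true h1 (by decide)
      · exact iff_of_true h3 (by decide)
      · exact iff_of_false h1.not_gt (by decide)
      · exact iff_of_false (lt_irrefl _) (by decide)
      · exact iff_of_true h2 (by decide)
      · exact iff_of_false h3.not_gt (by decide)
      · exact iff_of_false h2.not_gt (by decide)
      · exact iff_of_false (lt_irrefl _) (by decide)

theorem Is12Representant.exists_lt_of_not_adj {n : ℕ} {H : SimpleGraph (Fin n)}
    {w : List (Fin n)} (h : Is12Representant H w) {i j : Fin n} (hij : i < j)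
    (hn : ¬ H.Adj i j) : ∃ a b : Fin w.length, w.get a = i ∧ w.get b = j ∧ a < b := by
  rw [h.2 i j hij] at hn
  push Not at hn
  obtain ⟨b, a, hb, ha, hle⟩ := hn
  refine ⟨a, b, ha, hb, hle.lt_of_ne ?_⟩
  rintro rfl
  exact hij.ne (ha.symm.trans hb)

/-- The label order of a graph represented by a `123`-avoiding word has none of the four
patterns. -/
theorem Is12Representant.no_patterns {n : ℕ} {H : SimpleGraph (Fin n)}
    {w : List (Fin n)} (h : Is12Representant H w) (hw : AvoidsPattern w [1, 2, 3]) :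
    ¬ HasPatternA H ∧ ¬ HasPatternB H ∧ ¬ HasPatternC H ∧ ¬ HasPatternD H := by
  have key : ∀ a b c : Fin w.length, a < b → b < c →
      w.get a < w.get b → w.get b < w.get c → False := fun a b c h1 h2 h3 h4 =>
    hw ((containsPattern_123_iff w).2 ⟨a, b, c, h1, h2, h3, h4⟩)
  refine ⟨?_, ?_, ?_, ?_⟩
  · rintro ⟨x, y, z, hxy, hyz, exy, eyz, exz⟩
    obtain ⟨p, hp⟩ := List.get_of_mem (h.1 y)
    refine exz ((h.2 x z (hxy.trans hyz)).2 fun a b ha hb => ?_)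
    exact ((h.2 y z hyz).1 eyz a p ha hp).trans ((h.2 x y hxy).1 exy p b hp hb)
  · rintro ⟨x, y, z, w', hxy, hyz, hzw, eyz, exz, eyw⟩
    -- In this and the next two cases each non-edge gives an ascent, and the edge forces one ascent
    -- to precede the other; three of the four letters then form a `123`.
    obtain ⟨p, q, rfl, rfl, hpq⟩ := h.exists_lt_of_not_adj (hxy.trans hyz) exz
    obtain ⟨r, s, rfl, rfl, hrs⟩ := h.exists_lt_of_not_adj (hyz.trans hzw) eyw
    exact key p q s hpq (((h.2 _ _ hyz).1 eyz q r rfl rfl).trans hrs) (hxy.trans hyz) hzw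
  · rintro ⟨x, y, z, w', hxy, hyz, hzw, exz, exw, eyz⟩
    obtain ⟨p, q, rfl, rfl, hpq⟩ := h.exists_lt_of_not_adj (hxy.trans (hyz.trans hzw)) exw
    obtain ⟨r, s, rfl, rfl, hrs⟩ := h.exists_lt_of_not_adj hyz eyz
    exact key r s q hrs (((h.2 _ _ (hxy.trans hyz)).1 exz s p rfl rfl).trans hpq) hyz hzw
  · rintro ⟨x, y, z, w', hxy, hyz, hzw, eyw, exw, eyz⟩
    obtain ⟨p, q, rfl, rfl, hpq⟩ := h.exists_lt_of_not_adj (hxy.trans (hyz.trans hzw)) exw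
    obtain ⟨r, s, rfl, rfl, hrs⟩ := h.exists_lt_of_not_adj hyz eyz
    exact key p r s (hpq.trans ((h.2 _ _ (hyz.trans hzw)).1 eyw q r rfl rfl)) hrs hxy hyz

/-! ### From pattern-free orders to shift models -/

/-- A placement `c` of the vertices on the real line, in increasing order, together with sets
`P` and `Q` covering the vertices, such that `x < y` are non-adjacent iff `x ∈ P`, `y ∈ Q` and
their distance is at most `1`; distance exactly `1` does not occur for such pairs. -/
structure IsShiftModel {V : Type*} [LinearOrder V] (G : SimpleGraph V) (P Q : V → Prop)
    (c : V → ℝ) : Prop where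
  cover : ∀ x, P x ∨ Q x
  strictMono : StrictMono c
  far : ∀ ⦃x y⦄, x < y → G.Adj x y → P x → Q y → c x + 1 < c y
  near : ∀ ⦃x y⦄, x < y → ¬ G.Adj x y → P x ∧ Q y ∧ c y < c x + 1

/-- A relation on a finite linear order that is inherited by subintervals is the relation
"at distance less than `1`" for some increasing placement on the real line. -/
theorem exists_unit_placement {V : Type*} [LinearOrder V] (M : V → V → Prop)
    (hM : ∀ x x' y' y, x ≤ x' → x' < y' → y' ≤ y → M x y → M x' y') (s : Finset V) :
    ∃ c : V → ℝ, ∀ x ∈ s, ∀ y ∈ s, x < y →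
      c x < c y ∧ (M x y → c y < c x + 1) ∧ (¬ M x y → c x + 1 < c y) := by
  classical
  induction s using Finset.induction_on_max with
  | empty => exact ⟨0, by simp⟩
  | insert a s ha ih =>
    obtain ⟨c, hc⟩ := ih
    have hmono : ∀ x ∈ s, ∀ y ∈ s, x ≤ y → c x ≤ c y := fun x hx y hy hxy =>
      hxy.eq_or_lt.elim (fun h => h ▸ le_rfl) fun h => (hc x hx y hy h).1.le
    -- The new maximum must lie beyond all old points and beyond `c x + 1` for unrelated `x`, but
    -- before `c x + 1` for related `x`. Heredity of `M` makes these bounds compatible.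
    obtain ⟨m, hlo, hhi⟩ := Order.exists_between_finsets
      (s.image c ∪ (s.filter fun x => ¬ M x a).image fun x => c x + 1)
      ((s.filter fun x => M x a).image fun x => c x + 1) (by
        intro u hu v hv
        obtain ⟨y, hy, rfl⟩ := Finset.mem_image.1 hv
        obtain ⟨hys, hya⟩ := Finset.mem_filter.1 hy
        rcases Finset.mem_union.1 hu with hu | hu
        · obtain ⟨x, hx, rfl⟩ := Finset.mem_image.1 hu
          rcases lt_or_ge y x with hyx | hxy
          · exact (hc y hys x hx hyx).2.1 (hM y y x a le_rfl hyx (ha x hx).le hya)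
          · linarith [hmono x hx y hys hxy]
        · obtain ⟨x, hx, rfl⟩ := Finset.mem_image.1 hu
          obtain ⟨hxs, hxa⟩ := Finset.mem_filter.1 hx
          rcases lt_or_ge x y with hxy | hyx
          · linarith [(hc x hxs y hys hxy).1]
          · exact absurd (hM y x a a hyx (ha x hxs) le_rfl hya) hxa)
    have hne : ∀ x ∈ s, x ≠ a := fun x hx => (ha x hx).ne
    refine ⟨Function.update c a m, fun x hx y hy hxy => ?_⟩
    rcases Finset.mem_insert.1 hx with rfl | hxs <;> rcases Finset.mem_insert.1 hy with rfl | hys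
    · exact absurd hxy (lt_irrefl _)
    · exact absurd (ha y hys) hxy.not_gt
    · rw [Function.update_self, Function.update_of_ne (hne x hxs)]
      refine ⟨hlo _ ?_, fun h => hhi _ ?_, fun h => hlo _ ?_⟩
      · exact Finset.mem_union_left _ (Finset.mem_image_of_mem _ hxs)
      · exact Finset.mem_image.2 ⟨x, Finset.mem_filter.2 ⟨hxs, h⟩, rfl⟩
      · exact Finset.mem_union_right _
          (Finset.mem_image.2 ⟨x, Finset.mem_filter.2 ⟨hxs, h⟩, rfl⟩)
    · rw [Function.update_of_ne (hne x hxs), Function.update_of_ne (hne y hys)]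
      exact hc x hxs y hys hxy

theorem exists_isShiftModel_of_no_patterns {V : Type*} [LinearOrder V] [Finite V]
    (G : SimpleGraph V) (hA : ¬ HasPatternA G) (hB : ¬ HasPatternB G) (hC : ¬ HasPatternC G)
    (hD : ¬ HasPatternD G) : ∃ P Q c, IsShiftModel G P Q c := by
  have := Fintype.ofFinite V
  let P : V → Prop := fun x => ∃ y, x < y ∧ ¬ G.Adj x y
  let R : V → Prop := fun y => ∃ x, x < y ∧ ¬ G.Adj x y
  -- The closure of non-adjacency under passing to subintervals.
  let M : V → V → Prop := fun x y => ∃ x₀ y₀, x₀ ≤ x ∧ y ≤ y₀ ∧ x₀ < y₀ ∧ ¬ G.Adj x₀ y₀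
  have right : ∀ x y y', x < y' → y' < y → ¬ G.Adj x y → R y' → ¬ G.Adj x y' := by
    rintro x y y' h1 h2 hn ⟨p, hp, hpn⟩ he
    rcases lt_trichotomy p x with h | rfl | h
    · exact hB ⟨p, x, y', y, h, h1, h2, he, hpn, hn⟩
    · exact hpn he
    · exact hC ⟨x, p, y', y, h, hp, h2, he, hn, hpn⟩
  have left : ∀ x x' y, x < x' → x' < y → ¬ G.Adj x y → P x' → ¬ G.Adj x' y := by
    rintro x x' y h1 h2 hn ⟨w, hw, hwn⟩ he
    rcases lt_trichotomy w y with h | rfl | h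
    · exact hD ⟨x, x', w, y, h1, hw, h, he, hn, hwn⟩
    · exact hwn he
    · exact hB ⟨x, x', y, w, h1, h2, h, he, hn, hwn⟩
  -- Shrink the enclosing non-edge to `x, y`, first on the left, then on the right. If `y` has no
  -- earlier non-neighbour, it has no later one either, and pattern A applies.
  have inner : ∀ x y, x < y → P x → (R y ∨ ¬ P y) → M x y → ¬ G.Adj x y := by
    rintro x y hxy hx hy ⟨x₀, y₀, h1, h2, -, hn⟩
    have hn' : ¬ G.Adj x y₀ := by
      rcases h1.eq_or_lt with rfl | h1
      · exact hn
      · exact left _ _ _ h1 (hxy.trans_le h2) hn hx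
    rcases h2.eq_or_lt with rfl | h2
    · exact hn'
    by_cases hR : R y
    · exact right _ _ _ hxy h2 hn' hR
    · intro he
      refine hA ⟨x, y, y₀, hxy, h2, he, ?_, hn'⟩
      by_contra h
      exact hy.resolve_left hR ⟨y₀, h2, h⟩
  obtain ⟨c, hc⟩ := exists_unit_placement M (by
    rintro x x' y' y hx - hy ⟨x₀, y₀, h1, h2, h3⟩
    exact ⟨x₀, y₀, h1.trans hx, hy.trans h2, h3⟩) Finset.univ
  have hc' := fun x y => hc x (Finset.mem_univ x) y (Finset.mem_univ y)
  -- Adding `¬ P y` to `R y` ensures that every vertex has a role.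
  refine ⟨P, fun y => R y ∨ ¬ P y, c, ⟨fun x => ?_, fun x y h => (hc' x y h).1, ?_, ?_⟩⟩
  · by_cases h : P x
    · exact Or.inl h
    · exact Or.inr (Or.inr h)
  · intro x y hxy he hx hy
    exact (hc' x y hxy).2.2 fun hM => inner x y hxy hx hy hM he
  · intro x y hxy hn
    exact ⟨⟨y, hxy, hn⟩, Or.inl ⟨x, hxy, hn⟩,
      (hc' x y hxy).2.1 ⟨x, y, le_rfl, le_rfl, hxy, hn⟩⟩

/-! ### From shift models to words -/

/-- A finite set of a linear order, listed increasingly and relabeled by `g`. -/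
theorem exists_word_orderIso {α β : Type*} [LinearOrder α] (T : Finset α) (g : α → β) :
    ∃ (w : List β) (e : Fin w.length ≃o T), ∀ a, w.get a = g (e a) := by
  refine ⟨List.ofFn fun i => g (T.orderIsoOfFin rfl i),
    (Fin.castOrderIso (List.length_ofFn)).trans (T.orderIsoOfFin rfl), fun a => ?_⟩
  rw [List.get_ofFn]
  rfl

theorem IsShiftModel.exists_word {n : ℕ} {H : SimpleGraph (Fin n)} {P Q : Fin n → Prop}
    {c : Fin n → ℝ} (h : IsShiftModel H P Q c) :
    ∃ w, Is12Representant H w ∧ AvoidsPattern w [1, 2, 3] := by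
  classical
  -- The first coordinate is the position, the second the letter written there.
  let T : Finset (ℝ ×ₗ Fin n) :=
    (Finset.univ.filter P).image (fun x => toLex (-c x, x)) ∪
      (Finset.univ.filter Q).image (fun x => toLex (1 - c x, x))
  have memP : ∀ x, P x → toLex (-c x, x) ∈ T := fun x hx =>
    Finset.mem_union_left _ (Finset.mem_image.2 ⟨x, by simpa using hx, rfl⟩)
  have memQ : ∀ x, Q x → toLex (1 - c x, x) ∈ T := fun x hx =>
    Finset.mem_union_right _ (Finset.mem_image.2 ⟨x, by simpa using hx, rfl⟩)
  have cases : ∀ t : T, ∃ x, (P x ∧ t.1 = toLex (-c x, x)) ∨ (Q x ∧ t.1 = toLex (1 - c x, x)) := by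
    rintro ⟨t, ht⟩
    rcases Finset.mem_union.1 ht with ht | ht <;> obtain ⟨x, hx, rfl⟩ := Finset.mem_image.1 ht
    · exact ⟨x, Or.inl ⟨by simpa using hx, rfl⟩⟩
    · exact ⟨x, Or.inr ⟨by simpa using hx, rfl⟩⟩
  have lt_of : ∀ (u v : ℝ) (i j : Fin n), u < v → toLex (u, i) < toLex (v, j) :=
    fun u v i j huv => Prod.Lex.toLex_lt_toLex.2 (Or.inl huv)
  obtain ⟨w, e, he⟩ := exists_word_orderIso T (fun t => (ofLex t).2)
  have ge : ∀ t : T, w.get (e.symm t) = (ofLex t.1).2 := fun t => by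
    rw [he, OrderIso.apply_symm_apply]
  refine ⟨w, ⟨fun i => ?_, fun i j hij => ⟨fun hadj a b ha hb => ?_, fun hall => ?_⟩⟩, ?_⟩
  · rcases h.cover i with hi | hi
    · have := ge ⟨_, memP i hi⟩
      exact List.mem_iff_get.2 ⟨_, this⟩
    · have := ge ⟨_, memQ i hi⟩
      exact List.mem_iff_get.2 ⟨_, this⟩
  · rw [← e.lt_iff_lt, ← Subtype.coe_lt_coe]
    rw [he] at ha hb
    have hc := h.strictMono hij
    obtain ⟨j', hj⟩ := cases (e a)
    obtain ⟨i', hi⟩ := cases (e b)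
    rcases hj with ⟨hj, hj'⟩ | ⟨hj, hj'⟩ <;> rcases hi with ⟨hi, hi'⟩ | ⟨hi, hi'⟩ <;>
      rw [hj'] at ha ⊢ <;> rw [hi'] at hb ⊢ <;> obtain rfl : j' = j := ha <;>
      obtain rfl : i' = i := hb <;> apply lt_of
    · linarith
    · linarith
    · linarith [h.far hij hadj hi hj]
    · linarith
  · by_contra hn
    obtain ⟨hi, hj, hlt⟩ := h.near hij hn
    have h1 := hall _ _ (ge ⟨_, memQ j hj⟩) (ge ⟨_, memP i hi⟩)
    rw [e.symm.lt_iff_lt, ← Subtype.coe_lt_coe] at h1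
    exact lt_asymm h1 (lt_of _ _ _ _ (by linarith))
  · intro hcon
    obtain ⟨p, q, r, hpq, hqr, h1, h2⟩ := (containsPattern_123_iff w).1 hcon
    -- An ascent must go from a `P`-copy to a `Q`-copy, so the middle of a `123` would be both.
    have dec : ∀ (a b : Fin w.length), a < b → w.get a < w.get b → ∃ x y : Fin n,
        (e a).1 = toLex (-c x, x) ∧ (e b).1 = toLex (1 - c y, y) := by
      intro a b hab hlt
      rw [← e.lt_iff_lt, ← Subtype.coe_lt_coe] at hab
      rw [he, he] at hlt
      obtain ⟨x, hx⟩ := cases (e a)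
      obtain ⟨y, hy⟩ := cases (e b)
      rcases hx with ⟨-, hx⟩ | ⟨-, hx⟩ <;> rcases hy with ⟨-, hy⟩ | ⟨-, hy⟩ <;>
        rw [hx, hy] at hlt hab
      · exact absurd hab (lt_of _ _ _ _ (neg_lt_neg (h.strictMono hlt))).not_gt
      · exact ⟨x, y, hx, hy⟩
      · have := h.strictMono (show x < y from hlt)
        exact absurd hab (lt_of _ _ _ _ (by linarith)).not_gt
      · have := h.strictMono (show x < y from hlt)
        exact absurd hab (lt_of _ _ _ _ (by linarith)).not_gt
    obtain ⟨-, y, -, hy⟩ := dec p q hpq h1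
    obtain ⟨z, -, hz, -⟩ := dec q r hqr h2
    have heq := toLex.injective (hy.symm.trans hz)
    obtain ⟨h3, rfl⟩ := Prod.mk.inj heq
    linarith

theorem IsShiftModel.comap {V W : Type*} [LinearOrder V] [LinearOrder W] {G : SimpleGraph V}
    {P Q : V → Prop} {c : V → ℝ} (h : IsShiftModel G P Q c) (e : W ≃o V) :
    IsShiftModel (G.comap e) (P ∘ e) (Q ∘ e) (c ∘ e) where
  cover x := h.cover (e x)
  strictMono := h.strictMono.comp e.strictMono
  far _ _ hxy := h.far (e.strictMono hxy)
  near _ _ hxy := h.near (e.strictMono hxy)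

/-! ### Unit hooks and sticks -/

/-- The unit-length shape with corner `(c, -c)`, of kind `0` (horizontal stick), `1` (hook) or
`2` (vertical stick). -/
def unitShape (k : Fin 3) (c : ℝ) : Set (ℝ × ℝ) :=
  {p | (k ≠ 2 ∧ p.2 = -c ∧ c ≤ p.1 ∧ p.1 ≤ c + 1) ∨
    (k ≠ 0 ∧ p.1 = c ∧ -c ≤ p.2 ∧ p.2 ≤ -c + 1)}

theorem segment_horizontal (c d : ℝ) :
    segment ℝ (c, d) (c + 1, d) = {p : ℝ × ℝ | p.2 = d ∧ c ≤ p.1 ∧ p.1 ≤ c + 1} := by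
  rw [← Prod.image_mk_segment_left, segment_eq_Icc (by linarith)]
  ext ⟨x, y⟩
  simp only [Set.mem_image, Set.mem_Icc, Prod.mk.injEq, Set.mem_ofPred_eq]
  constructor
  · rintro ⟨_, h, rfl, rfl⟩
    exact ⟨rfl, h⟩
  · rintro ⟨rfl, h⟩
    exact ⟨x, h, rfl, rfl⟩

theorem segment_vertical (c d : ℝ) :
    segment ℝ (c, d) (c, d + 1) = {p : ℝ × ℝ | p.1 = c ∧ d ≤ p.2 ∧ p.2 ≤ d + 1} := by
  rw [← Prod.image_mk_segment_right, segment_eq_Icc (by linarith)]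
  ext ⟨x, y⟩
  simp only [Set.mem_image, Set.mem_Icc, Prod.mk.injEq, Set.mem_ofPred_eq]
  constructor
  · rintro ⟨_, h, rfl, rfl⟩
    exact ⟨rfl, h⟩
  · rintro ⟨rfl, h⟩
    exact ⟨y, h, rfl, rfl⟩

theorem unitShape_zero (c : ℝ) : unitShape 0 c = segment ℝ (c, -c) (c + 1, -c) := by
  rw [segment_horizontal]
  ext p
  simp [unitShape]

theorem unitShape_two (c : ℝ) : unitShape 2 c = segment ℝ (c, -c) (c, -c + 1) := by
  rw [segment_vertical]
  ext p
  simp [unitShape]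

theorem unitShape_one (c : ℝ) : unitShape 1 c = lShape (c, -c) 1 1 := by
  rw [lShape, segment_horizontal, segment_vertical, Set.union_comm]
  ext p
  simp [unitShape]

theorem isUnitHook_or_isUnitStick_iff (S : Set (ℝ × ℝ)) :
    IsUnitHook S ∨ IsUnitStick S ↔ ∃ k c, S = unitShape k c := by
  constructor
  · rintro (⟨⟨c, d⟩, hd, rfl⟩ | ⟨⟨c, d⟩, hd, rfl | rfl⟩) <;> obtain rfl : d = -c := hd
    · exact ⟨1, c, (unitShape_one c).symm⟩
    · exact ⟨0, c, (unitShape_zero c).symm⟩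
    · exact ⟨2, c, (unitShape_two c).symm⟩
  · rintro ⟨k, c, rfl⟩
    fin_cases k
    · exact Or.inr ⟨(c, -c), rfl, Or.inl (unitShape_zero c)⟩
    · exact Or.inl ⟨(c, -c), rfl, unitShape_one c⟩
    · exact Or.inr ⟨(c, -c), rfl, Or.inr (unitShape_two c)⟩

theorem corner_mem_unitShape (k : Fin 3) (c : ℝ) : (c, -c) ∈ unitShape k c := by
  by_cases hk : k = 0
  · exact Or.inl ⟨by rw [hk]; decide, rfl, le_rfl, by simp⟩
  · exact Or.inr ⟨hk, rfl, le_rfl, by simp⟩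

/-- The only possible meeting point is `(d, -c)`, on the horizontal arm of the left shape and the
vertical arm of the right one. -/
theorem unitShape_inter_nonempty_iff {k l : Fin 3} {c d : ℝ} (h : c < d) :
    (unitShape k c ∩ unitShape l d).Nonempty ↔ k ≠ 2 ∧ l ≠ 0 ∧ d ≤ c + 1 := by
  constructor
  · rintro ⟨⟨x, y⟩, h1 | h1, h2 | h2⟩ <;> obtain ⟨hk, h3, h4, h5⟩ := h1 <;>
      obtain ⟨hl, h6, h7, h8⟩ := h2 <;> dsimp only at h3 h4 h5 h6 h7 h8
    · linarith
    · exact ⟨hk, hl, by linarith⟩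
    · linarith
    · linarith
  · rintro ⟨hk, hl, hd⟩
    refine ⟨(d, -c), Or.inl ⟨hk, rfl, h.le, hd⟩, Or.inr ⟨hl, rfl, ?_, ?_⟩⟩ <;> dsimp only <;>
      linarith

/-- The corner attains the least abscissa of its shape. -/
theorem unitShape_corner_injective {k l : Fin 3} {c d : ℝ} (h : unitShape k c = unitShape l d) :
    c = d := by
  have aux : ∀ {k l : Fin 3} {c d : ℝ}, unitShape k c = unitShape l d → d ≤ c := by
    intro k l c d h
    rcases h ▸ corner_mem_unitShape k c with h | h
    · exact h.2.2.1
    · exact h.2.1.ge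
  exact le_antisymm (aux h.symm) (aux h)

theorem IsShiftModel.isUnitHookStickGraph_compl {V : Type*} [LinearOrder V] {G : SimpleGraph V}
    {P Q : V → Prop} {c : V → ℝ} (h : IsShiftModel G P Q c) : IsUnitHookStickGraph Gᶜ := by
  classical
  let k : V → Fin 3 := fun x => if P x then if Q x then 1 else 0 else 2
  have kP : ∀ x, k x ≠ 2 ↔ P x := fun x => by
    by_cases hP : P x <;> by_cases hQ : Q x <;> simp [k, hP, hQ]
  have kQ : ∀ x, k x ≠ 0 ↔ Q x := fun x => by
    have := h.cover x
    by_cases hP : P x <;> by_cases hQ : Q x <;> simp_all [k]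
  refine ⟨fun x => unitShape (k x) (c x), fun x y hxy =>
    h.strictMono.injective (unitShape_corner_injective hxy),
    fun x => (isUnitHook_or_isUnitStick_iff _).2 ⟨_, _, rfl⟩, ?_⟩
  have main : ∀ x y, x < y →
      (¬ G.Adj x y ↔ (unitShape (k x) (c x) ∩ unitShape (k y) (c y)).Nonempty) := by
    intro x y hxy
    rw [unitShape_inter_nonempty_iff (h.strictMono hxy), kP, kQ]
    constructor
    · intro hn
      obtain ⟨h1, h2, h3⟩ := h.near hxy hn
      exact ⟨h1, h2, h3.le⟩
    · rintro ⟨h1, h2, h3⟩ he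
      exact (h.far hxy he h1 h2).not_ge h3
  ext x y
  rw [SimpleGraph.compl_adj]
  refine and_congr_right fun hne => ?_
  rcases hne.lt_or_gt with hxy | hxy
  · exact main x y hxy
  · rw [SimpleGraph.adj_comm, main y x hxy, Set.inter_comm]

/-- The order of the corners, refined by the kinds of the shapes at a common corner, has none of
the four patterns. -/
theorem no_patterns_of_unitShape {V : Type*} [LinearOrder V] {G : SimpleGraph V}
    (k : V → Fin 3) (c : V → ℝ)
    (hlt : ∀ x y, x < y → c x < c y ∨ c x = c y ∧ k x < k y)
    (hG : ∀ x y, x ≠ y →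
      (¬ G.Adj x y ↔ (unitShape (k x) (c x) ∩ unitShape (k y) (c y)).Nonempty)) :
    ¬ HasPatternA G ∧ ¬ HasPatternB G ∧ ¬ HasPatternC G ∧ ¬ HasPatternD G := by
  have mono : ∀ x y, x < y → c x ≤ c y := fun x y h => (hlt x y h).elim le_of_lt fun h => h.1.le
  have main : ∀ x y, x < y → (¬ G.Adj x y ↔ k x ≠ 2 ∧ k y ≠ 0 ∧ c y ≤ c x + 1) := by
    intro x y hxy
    rw [hG x y hxy.ne]
    rcases hlt x y hxy with h | ⟨h, hk⟩
    · exact unitShape_inter_nonempty_iff h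
    -- At a common corner the shapes meet, and `k x < k y` makes the right-hand side hold too.
    · refine iff_of_true ⟨(c x, -c x), corner_mem_unitShape _ _, ?_⟩ ⟨?_, ?_, ?_⟩
      · rw [h]
        exact corner_mem_unitShape _ _
      · omega
      · omega
      · linarith
  refine ⟨?_, ?_, ?_, ?_⟩
  · rintro ⟨x, y, z, hxy, hyz, exy, eyz, exz⟩
    obtain ⟨h1, h2, h3⟩ := (main x z (hxy.trans hyz)).1 exz
    -- Since `y` is within reach of `x`, the edge `xy` can only come from a missing vertical arm at
    -- `y`.
    have hy : k y = 0 := by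
      by_contra h
      exact (main x y hxy).2 ⟨h1, h, (mono y z hyz).trans h3⟩ exy
    exact (main y z hyz).2 ⟨by rw [hy]; decide, h2, by linarith [mono x y hxy]⟩ eyz
  · rintro ⟨x, y, z, w, hxy, hyz, hzw, eyz, exz, eyw⟩
    -- Here and in the next two cases, the non-edges supply both arms, and one of them spans the
    -- supposed edge, which bounds its length.
    obtain ⟨h1, h2, h3⟩ := (main x z (hxy.trans hyz)).1 exz
    obtain ⟨h4, h5, h6⟩ := (main y w (hyz.trans hzw)).1 eyw
    exact (main y z hyz).2 ⟨h4, h2, by linarith [mono z w hzw]⟩ eyz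
  · rintro ⟨x, y, z, w, hxy, hyz, hzw, exz, exw, eyz⟩
    obtain ⟨h1, h2, h3⟩ := (main x w (hxy.trans (hyz.trans hzw))).1 exw
    obtain ⟨h4, h5, h6⟩ := (main y z hyz).1 eyz
    exact (main x z (hxy.trans hyz)).2 ⟨h1, h5, by linarith [mono z w hzw]⟩ exz
  · rintro ⟨x, y, z, w, hxy, hyz, hzw, eyw, exw, eyz⟩
    obtain ⟨h1, h2, h3⟩ := (main x w (hxy.trans (hyz.trans hzw))).1 exw
    obtain ⟨h4, h5, h6⟩ := (main y z hyz).1 eyz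
    exact (main y w (hyz.trans hzw)).2 ⟨h4, h2, by linarith [mono x y hxy]⟩ eyw

/-! ### Transfer to unlabeled graphs and the equivalence -/

theorem exists_no_patterns_of_avoiding {V : Type*} [Fintype V] {G : SimpleGraph V}
    (h : Is12RepresentableAvoiding G [1, 2, 3]) : ∃ _ : LinearOrder V,
      ¬ HasPatternA G ∧ ¬ HasPatternB G ∧ ¬ HasPatternC G ∧ ¬ HasPatternD G := by
  obtain ⟨H, ⟨e⟩, w, hw, hav⟩ := h
  obtain ⟨hA, hB, hC, hD⟩ := hw.no_patterns hav
  refine ⟨LinearOrder.lift' e e.injective, ?_, ?_, ?_, ?_⟩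
  · rintro ⟨x, y, z, h⟩
    exact hA ⟨e x, e y, e z, by simp only [e.map_adj_iff]; exact h⟩
  · rintro ⟨x, y, z, w, h⟩
    exact hB ⟨e x, e y, e z, e w, by simp only [e.map_adj_iff]; exact h⟩
  · rintro ⟨x, y, z, w, h⟩
    exact hC ⟨e x, e y, e z, e w, by simp only [e.map_adj_iff]; exact h⟩
  · rintro ⟨x, y, z, w, h⟩
    exact hD ⟨e x, e y, e z, e w, by simp only [e.map_adj_iff]; exact h⟩

theorem IsShiftModel.is12RepresentableAvoiding {V : Type*} [Fintype V] [LinearOrder V]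
    {G : SimpleGraph V} {P Q : V → Prop} {c : V → ℝ} (h : IsShiftModel G P Q c) :
    Is12RepresentableAvoiding G [1, 2, 3] := by
  let e : Fin (Fintype.card V) ≃o V := Fintype.orderIsoFinOfCardEq V rfl
  exact ⟨G.comap e, ⟨(SimpleGraph.Iso.comap e.toEquiv G).symm⟩, (h.comap e).exists_word⟩

theorem IsUnitHookStickGraph.exists_no_patterns_compl {V : Type*} {H : SimpleGraph V}
    (h : IsUnitHookStickGraph H) : ∃ _ : LinearOrder V,
      ¬ HasPatternA Hᶜ ∧ ¬ HasPatternB Hᶜ ∧ ¬ HasPatternC Hᶜ ∧ ¬ HasPatternD Hᶜ := by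
  obtain ⟨S, hinj, hS, rfl⟩ := h
  choose k c hkc using fun v => (isUnitHook_or_isUnitStick_iff _).1 (hS v)
  -- Vertices with equal corner and kind would share a shape, so the key is injective.
  let key : V → ℝ ×ₗ Fin 3 := fun v => toLex (c v, k v)
  have hkey : Function.Injective key := by
    intro u v huv
    obtain ⟨h1, h2⟩ := Prod.mk.inj (toLex.injective huv)
    exact hinj (by rw [hkc, hkc, h1, h2])
  let _ : LinearOrder V := LinearOrder.lift' key hkey
  refine ⟨inferInstance, no_patterns_of_unitShape k c (fun x y hxy => ?_) fun x y hxy => ?_⟩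
  · exact Prod.Lex.toLex_lt_toLex.1 (show key x < key y from hxy)
  · rw [← hkc, ← hkc, SimpleGraph.compl_adj]
    simp [intersectionGraph, hxy]

theorem mainTheorem1 {V : Type*} [Fintype V] (G : SimpleGraph V) :
    List.TFAE [
      Is12RepresentableAvoiding G [1, 2, 3],
      ∃ _ : LinearOrder V,
        ¬ HasPatternA G ∧ ¬ HasPatternB G ∧ ¬ HasPatternC G ∧ ¬ HasPatternD G,
      ∃ H : SimpleGraph V, IsUnitHookStickGraph H ∧ G = Hᶜ] := by
  tfae_have 1 → 2 := exists_no_patterns_of_avoiding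
  tfae_have 2 → 1 := by
    rintro ⟨_, hA, hB, hC, hD⟩
    obtain ⟨P, Q, c, h⟩ := exists_isShiftModel_of_no_patterns G hA hB hC hD
    exact h.is12RepresentableAvoiding
  tfae_have 2 → 3 := by
    rintro ⟨_, hA, hB, hC, hD⟩
    obtain ⟨P, Q, c, h⟩ := exists_isShiftModel_of_no_patterns G hA hB hC hD
    exact ⟨Gᶜ, h.isUnitHookStickGraph_compl, (compl_compl G).symm⟩
  tfae_have 3 → 2 := by
    rintro ⟨H, hH, rfl⟩
    exact hH.exists_no_patterns_compl
  tfae_finish
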